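/- Let $k$ be an algebraically closed field of characteristic different from $2$ and $3$, and let $P,Q$ be $3\times 3$ matrices over $k$. For column vectors $x,y$ of length $3$ put $$x^\sharp={}^tPx\times{}^tQx,\qquad y^\sharp=Py\times Qy,$$ where $\times$ is the cross product. When the entries of $P,Q,x,y$ are regarded as independent indeterminates over $k$, there are unique polynomials $N_x^{PQ}(x)$, $N_y^{PQ}(y)$ (cubic forms in $x$, resp. $y$, with coefficients in the polynomial ring $A$ in the entries of $P,Q$) such that $$(x^\sharp)^\sharp=N_x^{PQ}(x)\,x,\qquad (y^\sharp)^\sharp=N_y^{PQ}(y)\,y,$$ and there is a unique bilinear form $\beta^{PQ}(x,y)$ with coefficients in $A$ such that the directional derivatives satisfy $$\partial_{x'}N_x^{PQ}(x)=\beta^{PQ}(x',x^\sharp),\qquad \partial_{y'}N_y^{PQ}(y)=\beta^{PQ}(y^\sharp,y').$$ For the given matrices $P,Q$ over $k$, let $\beta^{PQ}$ denote the bilinear form over $k$ obtained by specialization, and let $D_\beta\in k$ be the determinant of its $3\times3$ matrix. Assume that $\beta^{PQ}$ is nondegenerate, i.e. $D_\beta\neq0$. Let $\mathfrak R^{PQ}$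 be the closed subscheme of the affine space $\mathbb A^8_k$ with coordinates $s,t,x=(x_1,x_2,x_3),y=(y_1,y_2,y_3)$ defined by the equations $$sx=Py\times Qy,\quad ty={}^tPx\times{}^tQx,\quad st=\tfrac13\,\beta^{PQ}(x,y),\quad {}^txPy=0,\quad {}^txQy=0.$$ Then $\mathfrak R^{PQ}$ is isomorphic, as a scheme over $k$, to the affine cone in $\mathbb A^8_k$ over the Segre embedding $\mathbb P^1\times\mathbb P^1\times\mathbb P^1\subset\mathbb P^7$, i.e. to the spectrum of the homogeneous coordinate ring of the Segre variety. -/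

import Mathlib

open scoped Matrix
open CategoryTheory AlgebraicGeometry

universe u

namespace SegreFTS

section Forms

variable {R : Type*} [CommRing R]

/-- `x^♯ = ᵗP x × ᵗQ x`. -/
def sharpX (P Q : Matrix (Fin 3) (Fin 3) R) (x : Fin 3 → R) : Fin 3 → R :=
  crossProduct (Pᵀ *ᵥ x) (Qᵀ *ᵥ x)

/-- `y^♯ = P y × Q y`. -/
def sharpY (P Q : Matrix (Fin 3) (Fin 3) R) (y : Fin 3 → R) : Fin 3 → R :=
  crossProduct (P *ᵥ y) (Q *ᵥ y)

/-- The cubic form `N_x^{PQ}`, in closed form; it is characterized by `(x^♯)^♯ = N_x^{PQ}(x) x`,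
see `existsUnique_normX` and `normX_spec`. -/
def normX (P Q : Matrix (Fin 3) (Fin 3) R) (x : Fin 3 → R) : R :=
  -(x ⬝ᵥ ((Q * P.adjugate * Q) *ᵥ sharpX P Q x))

/-- The cubic form `N_y^{PQ}`, in closed form; it is characterized by `(y^♯)^♯ = N_y^{PQ}(y) y`,
see `existsUnique_normY` and `normY_spec`. -/
def normY (P Q : Matrix (Fin 3) (Fin 3) R) (y : Fin 3 → R) : R :=
  -(sharpY P Q y ⬝ᵥ ((Q * P.adjugate * Q) *ᵥ y))

/-- The matrix of the bilinear form `β^{PQ}`, in closed form. For matrices `P, Q` of indeterminates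
it is the unique matrix with entries in the polynomial ring in the entries of `P, Q` such that
`∂_{x'} N_x^{PQ}(x) = β^{PQ}(x', x^♯)` and `∂_{y'} N_y^{PQ}(y) = β^{PQ}(y^♯, y')`
(`isTrace_betaMatrix`, `betaMatrix_unique`); for other `P, Q` it is the specialization of the
generic one (`betaMatrix_map`). -/
def betaMatrix (P Q : Matrix (Fin 3) (Fin 3) R) : Matrix (Fin 3) (Fin 3) R :=
  P * ((P + Q).adjugate - P.adjugate - Q.adjugate) * Q
    - Q * P.adjugate * Q - P * Q.adjugate * P

/-- The bilinear form `β^{PQ}(x, y)`. -/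
def beta (P Q : Matrix (Fin 3) (Fin 3) R) (x y : Fin 3 → R) : R :=
  x ⬝ᵥ (betaMatrix P Q *ᵥ y)

/-- `D_β`, the determinant of the matrix of `β^{PQ}`. -/
def dBeta (P Q : Matrix (Fin 3) (Fin 3) R) : R :=
  (betaMatrix P Q).det

theorem sharpX_eq (P Q : Matrix (Fin 3) (Fin 3) R) (x : Fin 3 → R) :
    sharpX P Q x = sharpY Pᵀ Qᵀ x := rfl

theorem transpose_mulVec_cross (P : Matrix (Fin 3) (Fin 3) R) (a b : Fin 3 → R) :
    Pᵀ *ᵥ crossProduct (P *ᵥ a) b = crossProduct a (P.adjugate *ᵥ b) := by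
  ext i
  fin_cases i <;>
  · simp [crossProduct, Matrix.mulVec, dotProduct, Fin.sum_univ_three, Matrix.adjugate_fin_three]
    ring

theorem adjugate_transpose_mulVec_cross (P : Matrix (Fin 3) (Fin 3) R) (a b : Fin 3 → R) :
    P.adjugateᵀ *ᵥ crossProduct a b = crossProduct (P *ᵥ a) (P *ᵥ b) := by
  ext i
  fin_cases i <;>
  · simp [crossProduct, Matrix.mulVec, dotProduct, Fin.sum_univ_three, Matrix.adjugate_fin_three]
    ring

theorem dotProduct_transpose_mulVec (A : Matrix (Fin 3) (Fin 3) R) (v w : Fin 3 → R) :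
    (Aᵀ *ᵥ v) ⬝ᵥ w = v ⬝ᵥ (A *ᵥ w) := by
  rw [Matrix.mulVec_transpose, Matrix.dotProduct_mulVec]

theorem cross_cross' (a b c : Fin 3 → R) :
    crossProduct (crossProduct a b) c = (a ⬝ᵥ c) • b - (b ⬝ᵥ c) • a := by
  ext i
  fin_cases i <;>
  · simp [crossProduct, dotProduct, Fin.sum_univ_three]
    ring

theorem normY_spec (P Q : Matrix (Fin 3) (Fin 3) R) (y : Fin 3 → R) :
    sharpX P Q (sharpY P Q y) = normY P Q y • y := by
  have h0 : y ⬝ᵥ (Qᵀ *ᵥ crossProduct (P *ᵥ y) (Q *ᵥ y)) = 0 := by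
    rw [dotProduct_comm, dotProduct_transpose_mulVec, dotProduct_comm, dot_cross_self]
  have h1 : (P.adjugate *ᵥ Q *ᵥ y) ⬝ᵥ (Qᵀ *ᵥ crossProduct (P *ᵥ y) (Q *ᵥ y)) =
      -normY P Q y := by
    rw [dotProduct_comm, dotProduct_transpose_mulVec, normY, neg_neg, sharpY,
      Matrix.mulVec_mulVec, Matrix.mulVec_mulVec, Matrix.mul_assoc]
  rw [sharpX, sharpY, transpose_mulVec_cross, cross_cross', h0, h1]
  simp

theorem normX_eq (P Q : Matrix (Fin 3) (Fin 3) R) (x : Fin 3 → R) :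
    normX P Q x = normY Pᵀ Qᵀ x := by
  rw [normX, normY, sharpX_eq, ← Matrix.adjugate_transpose, ← Matrix.transpose_mul,
    ← Matrix.transpose_mul, Matrix.mulVec_transpose, dotProduct_comm (sharpY _ _ _),
    ← Matrix.dotProduct_mulVec, Matrix.mul_assoc]

theorem normX_spec (P Q : Matrix (Fin 3) (Fin 3) R) (x : Fin 3 → R) :
    sharpY P Q (sharpX P Q x) = normX P Q x • x := by
  rw [normX_eq, ← normY_spec, sharpX_eq, sharpX_eq, Matrix.transpose_transpose,
    Matrix.transpose_transpose]

theorem betaMatrix_transpose (P Q : Matrix (Fin 3) (Fin 3) R) :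
    betaMatrix Pᵀ Qᵀ = (betaMatrix P Q)ᵀ := by
  have key : P * ((P + Q).adjugate - P.adjugate - Q.adjugate) * Q =
      Q * ((P + Q).adjugate - P.adjugate - Q.adjugate) * P := by
    have h1 : P * (P + Q).adjugate * Q = Q * (P + Q).adjugate * P := by
      have e1 : P * (P + Q).adjugate * (P + Q) = (P + Q) * (P + Q).adjugate * P := by
        rw [Matrix.mul_assoc, Matrix.adjugate_mul, Matrix.mul_adjugate]; simp
      simpa [Matrix.mul_add, Matrix.add_mul] using e1
    have h2 : P * P.adjugate * Q = Q * P.adjugate * P := by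
      rw [Matrix.mul_assoc Q, Matrix.adjugate_mul, Matrix.mul_adjugate]; simp
    have h3 : P * Q.adjugate * Q = Q * Q.adjugate * P := by
      rw [Matrix.mul_assoc P, Matrix.adjugate_mul, Matrix.mul_adjugate]; simp
    simp only [Matrix.mul_sub, Matrix.sub_mul, h1, h2, h3]
  rw [betaMatrix, betaMatrix, key]
  simp only [Matrix.transpose_sub, Matrix.transpose_mul, Matrix.adjugate_transpose,
    Matrix.transpose_add, Matrix.mul_assoc]

theorem beta_polar (P Q : Matrix (Fin 3) (Fin 3) R) (y z : Fin 3 → R) :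
    -((crossProduct (P *ᵥ z) (Q *ᵥ y) + crossProduct (P *ᵥ y) (Q *ᵥ z)) ⬝ᵥ
        ((Q * P.adjugate * Q) *ᵥ y) + sharpY P Q y ⬝ᵥ ((Q * P.adjugate * Q) *ᵥ z)) =
      beta P Q (sharpY P Q y) z := by
  set r := P.adjugate *ᵥ (Q *ᵥ y) with hr
  have hK : (Q * P.adjugate * Q) *ᵥ y = Q *ᵥ r := by
    rw [hr, Matrix.mulVec_mulVec, Matrix.mulVec_mulVec, Matrix.mul_assoc]
  have hPr : P *ᵥ r = P.det • (Q *ᵥ y) := by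
    rw [hr, Matrix.mulVec_mulVec, Matrix.mul_adjugate, Matrix.smul_mulVec, Matrix.one_mulVec]
  have hw : ∀ v, sharpY P Q y ⬝ᵥ (P *ᵥ v) = crossProduct y r ⬝ᵥ v := fun v => by
    rw [← dotProduct_transpose_mulVec, sharpY, transpose_mulVec_cross]
  have hadj : ∀ (A : Matrix (Fin 3) (Fin 3) R) v, crossProduct y r ⬝ᵥ (A.adjugate *ᵥ v) =
      crossProduct (A *ᵥ y) (A *ᵥ r) ⬝ᵥ v := fun A v => by
    rw [← dotProduct_transpose_mulVec, adjugate_transpose_mulVec_cross]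
  have hB : betaMatrix P Q *ᵥ z =
      P *ᵥ ((P + Q).adjugate *ᵥ (Q *ᵥ z)) - P *ᵥ (P.adjugate *ᵥ (Q *ᵥ z))
        - P *ᵥ (Q.adjugate *ᵥ (Q *ᵥ z)) - (Q * P.adjugate * Q) *ᵥ z
        - P *ᵥ (Q.adjugate *ᵥ (P *ᵥ z)) := by
    simp only [betaMatrix, Matrix.mulVec_mulVec, Matrix.mul_sub, Matrix.sub_mul,
      Matrix.sub_mulVec, Matrix.mul_assoc]
  rw [beta, hB, hK]
  simp only [dotProduct_sub, hw, hadj, Matrix.add_mulVec, hPr]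
  generalize Q *ᵥ y = a
  generalize Q *ᵥ z = b
  generalize Q *ᵥ r = c
  generalize P *ᵥ y = d
  generalize P *ᵥ z = e
  generalize sharpY P Q y ⬝ᵥ _ = f
  simp [crossProduct, dotProduct, Fin.sum_univ_three]
  ring

theorem derivation_dotProduct {S : Type*} [CommRing S] [Algebra R S] (D : Derivation R S S)
    (v w : Fin 3 → S) : D (v ⬝ᵥ w) = (D ∘ v) ⬝ᵥ w + v ⬝ᵥ (D ∘ w) := by
  simp [dotProduct, Fin.sum_univ_three]
  ring

theorem derivation_cross {S : Type*} [CommRing S] [Algebra R S] (D : Derivation R S S)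
    (v w : Fin 3 → S) :
    D ∘ crossProduct v w = crossProduct (D ∘ v) w + crossProduct v (D ∘ w) := by
  ext i
  fin_cases i <;>
  · simp [crossProduct]
    ring

theorem derivation_mulVec {S : Type*} [CommRing S] [Algebra R S] (D : Derivation R S S)
    (A : Matrix (Fin 3) (Fin 3) R) (v : Fin 3 → S) :
    D ∘ (A.map (algebraMap R S) *ᵥ v) = A.map (algebraMap R S) *ᵥ (D ∘ v) := by
  ext i
  simp [Matrix.mulVec, dotProduct, Fin.sum_univ_three]

theorem betaMatrix_map {S : Type*} [CommRing S] (f : R →+* S) (P Q : Matrix (Fin 3) (Fin 3) R) :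
    betaMatrix (P.map f) (Q.map f) = (betaMatrix P Q).map f := by
  have h : ∀ A : Matrix (Fin 3) (Fin 3) R, A.map f = f.mapMatrix A := fun _ => rfl
  simp only [betaMatrix, h, ← RingHom.map_adjugate, ← map_add, ← map_sub, ← map_mul]

theorem derivation_normY {S : Type*} [CommRing S] [Algebra R S] (D : Derivation R S S)
    (P Q : Matrix (Fin 3) (Fin 3) R) (y : Fin 3 → S) :
    D (normY (P.map (algebraMap R S)) (Q.map (algebraMap R S)) y) =
      beta (P.map (algebraMap R S)) (Q.map (algebraMap R S))
        (sharpY (P.map (algebraMap R S)) (Q.map (algebraMap R S)) y) (D ∘ y) := by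
  have h : ∀ A : Matrix (Fin 3) (Fin 3) R,
    A.map (algebraMap R S) = (algebraMap R S).mapMatrix A := fun _ => rfl
  have hK : Q.map (algebraMap R S) * (P.map (algebraMap R S)).adjugate * Q.map (algebraMap R S) =
      (Q * P.adjugate * Q).map (algebraMap R S) := by
    simp only [h, ← RingHom.map_adjugate, ← map_mul]
  rw [← beta_polar, normY, map_neg, derivation_dotProduct, hK, derivation_mulVec, sharpY,
    derivation_cross, derivation_mulVec, derivation_mulVec]

end Forms

section Characterization

open MvPolynomial

variable {R : Type*} [CommRing R]

/-- The identities `∂_{x'} N_x^{PQ}(x) = B(x', x^♯)` and `∂_{y'} N_y^{PQ}(y) = B(y^♯, y')` of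
polynomials in the coordinates of `x`, resp. `y`, with `x'`, `y'` running over the standard
basis vectors. -/
def IsTrace (P Q B : Matrix (Fin 3) (Fin 3) R) : Prop :=
  (∀ i, pderiv i (normX (P.map (C (σ := Fin 3))) (Q.map C) X) =
    (B.map C *ᵥ sharpX (P.map C) (Q.map C) X) i) ∧
  (∀ i, pderiv i (normY (P.map (C (σ := Fin 3))) (Q.map C) X) =
    (sharpY (P.map C) (Q.map C) X ᵥ* B.map C) i)

theorem isTrace_betaMatrix (P Q : Matrix (Fin 3) (Fin 3) R) : IsTrace P Q (betaMatrix P Q) := by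
  have key : ∀ (P Q : Matrix (Fin 3) (Fin 3) R) (i : Fin 3),
      pderiv i (normY (P.map (C (σ := Fin 3))) (Q.map C) X) =
        (sharpY (P.map C) (Q.map C) X ᵥ* (betaMatrix P Q).map C) i := by
    intro P Q i
    have h := derivation_normY (pderiv (R := R) i) P Q X
    have hX : (pderiv (R := R) i) ∘ X = Pi.single i 1 := by
      ext1 j
      simp [pderiv_X, Pi.single_apply, eq_comm]
    rw [hX, algebraMap_eq] at h
    rw [h, beta, Matrix.dotProduct_mulVec, betaMatrix_map, dotProduct_single_one]
  refine ⟨fun i => ?_, key P Q⟩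
  have h := key Pᵀ Qᵀ i
  rw [betaMatrix_transpose, Matrix.transpose_map, Matrix.transpose_map,
    Matrix.transpose_map, ← normX_eq, ← sharpX_eq, Matrix.vecMul_transpose] at h
  exact h

theorem existsUnique_normX (P Q : Matrix (Fin 3) (Fin 3) R) :
    ∃! N : MvPolynomial (Fin 3) R,
      sharpY (P.map C) (Q.map C) (sharpX (P.map C) (Q.map C) X) = N • X := by
  refine ⟨normX (P.map C) (Q.map C) X, normX_spec _ _ _, fun N hN => ?_⟩
  have h := congrFun (hN.symm.trans (normX_spec _ _ _)) 0
  simp only [Pi.smul_apply, smul_eq_mul] at h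
  exact X_mul_cancel_right_iff.mp h

theorem existsUnique_normY (P Q : Matrix (Fin 3) (Fin 3) R) :
    ∃! N : MvPolynomial (Fin 3) R,
      sharpX (P.map C) (Q.map C) (sharpY (P.map C) (Q.map C) X) = N • X := by
  refine ⟨normY (P.map C) (Q.map C) X, normY_spec _ _ _, fun N hN => ?_⟩
  have h := congrFun (hN.symm.trans (normY_spec _ _ _)) 0
  simp only [Pi.smul_apply, smul_eq_mul] at h
  exact X_mul_cancel_right_iff.mp h

/-- The generic matrix `P` (for `b = false`), resp. `Q` (for `b = true`): its entries are
independent indeterminates over `k`. -/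
noncomputable def genericMatrix (k : Type*) [CommRing k] (b : Bool) :
    Matrix (Fin 3) (Fin 3) (MvPolynomial (Bool × Fin 3 × Fin 3) k) :=
  Matrix.of fun i j => X (b, i, j)

theorem sharpX_map {S : Type*} [CommRing S] (f : R →+* S) (P Q : Matrix (Fin 3) (Fin 3) R)
    (x : Fin 3 → R) : f ∘ sharpX P Q x = sharpX (P.map f) (Q.map f) (f ∘ x) := by
  ext i
  fin_cases i <;>
    simp [sharpX, crossProduct, Matrix.mulVec, dotProduct, Fin.sum_univ_three]

/-- The matrix with columns `e^♯` for `e = (0, 1, 1), (1, 0, 1), (1, 1, 0)`. -/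
def sharpMatrix (P Q : Matrix (Fin 3) (Fin 3) R) : Matrix (Fin 3) (Fin 3) R :=
  Matrix.of fun i j => sharpX P Q (fun l => if l = j then 0 else 1) i

theorem sharpMatrix_map {S : Type*} [CommRing S] (f : R →+* S) (P Q : Matrix (Fin 3) (Fin 3) R) :
    (sharpMatrix P Q).map f = sharpMatrix (P.map f) (Q.map f) := by
  ext1 i j
  have h := congrFun (sharpX_map f P Q (fun l => if l = j then 0 else 1)) i
  have e : (f ∘ fun l : Fin 3 => if l = j then (0 : R) else 1) = fun l => if l = j then 0 else 1 := by
    ext1 l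
    simp [apply_ite f]
  rw [e] at h
  exact h

theorem IsTrace.eq_of_det_ne_zero [IsDomain R] {P Q B B' : Matrix (Fin 3) (Fin 3) R}
    (hB : IsTrace P Q B) (hB' : IsTrace P Q B') (hdet : (sharpMatrix P Q).det ≠ 0) : B = B' := by
  have hv : ∀ v : Fin 3 → R, B *ᵥ sharpX P Q v = B' *ᵥ sharpX P Q v := by
    intro v
    have hmap : ∀ A : Matrix (Fin 3) (Fin 3) R,
        (A.map (C (σ := Fin 3))).map (eval v) = A := fun A => by ext1 i j; simp
    have hX : eval v ∘ X = v := by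
      ext1 i
      simp
    have hb : ∀ A : Matrix (Fin 3) (Fin 3) R,
        (eval v) ∘ (A.map C *ᵥ sharpX (P.map C) (Q.map C) X) = A *ᵥ sharpX P Q v := by
      intro A
      ext1 i
      rw [Function.comp_apply, RingHom.map_mulVec, hmap, sharpX_map, hmap, hmap, hX]
    have h : B.map C *ᵥ sharpX (P.map C) (Q.map C) X =
        B'.map C *ᵥ sharpX (P.map C) (Q.map C) X := by
      ext1 i
      rw [← hB.1 i, ← hB'.1 i]
    rw [← hb, ← hb, h]
  ext1 i j
  have hrow : (fun l => (B - B') i l) = 0 := by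
    apply Matrix.eq_zero_of_vecMul_eq_zero hdet
    ext1 j
    have h := congrFun (sub_eq_zero.mpr (hv fun l => if l = j then 0 else 1)) i
    rw [← Matrix.sub_mulVec] at h
    exact h
  exact sub_eq_zero.mp (congrFun hrow j)

theorem betaMatrix_unique (k : Type*) [Field k]
    (B : Matrix (Fin 3) (Fin 3) (MvPolynomial (Bool × Fin 3 × Fin 3) k))
    (hB : IsTrace (genericMatrix k false) (genericMatrix k true) B) :
    B = betaMatrix (genericMatrix k false) (genericMatrix k true) := by
  refine hB.eq_of_det_ne_zero (isTrace_betaMatrix _ _) ?_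
  set P := genericMatrix k false with hP
  set Q := genericMatrix k true with hQ
  intro h0
  have h1 := congrArg (eval fun a : Bool × Fin 3 × Fin 3 =>
    (if a.1 then Matrix.diagonal ![0, 1, 1] a.2.1 a.2.2
      else Matrix.diagonal ![1, 0, 1] a.2.1 a.2.2 : k)) h0
  rw [RingHom.map_det, map_zero, RingHom.mapMatrix_apply, sharpMatrix_map] at h1
  have e1 : P.map (eval fun a : Bool × Fin 3 × Fin 3 =>
    (if a.1 then Matrix.diagonal ![0, 1, 1] a.2.1 a.2.2
      else Matrix.diagonal ![1, 0, 1] a.2.1 a.2.2 : k)) = Matrix.diagonal ![1, 0, 1] := by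
    ext1 i j
    simp [hP, genericMatrix]
  have e2 : Q.map (eval fun a : Bool × Fin 3 × Fin 3 =>
    (if a.1 then Matrix.diagonal ![0, 1, 1] a.2.1 a.2.2
      else Matrix.diagonal ![1, 0, 1] a.2.1 a.2.2 : k)) = Matrix.diagonal ![0, 1, 1] := by
    ext1 i j
    simp [hQ, genericMatrix]
  rw [e1, e2, Matrix.det_fin_three] at h1
  simp [sharpMatrix, sharpX, crossProduct, Matrix.mulVec_diagonal] at h1

end Characterization

section Schemes

open MvPolynomial LinearAlgebra.Projectivization

variable (k : Type u) [Field k]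

/-- The affine scheme `Spec A` over `Spec k`, for a `k`-algebra `A`. -/
noncomputable def specOver (A : Type u) [CommRing A] [Algebra k A] :
    Over (Spec (CommRingCat.of k)) :=
  Over.mk (Spec.map (CommRingCat.ofHom (algebraMap k A)))

/-- The coordinates `s, t, x₁, x₂, x₃, y₁, y₂, y₃` on the affine space `V = k ⊕ k ⊕ V_x ⊕ V_y`. -/
inductive Coord : Type
  | s : Coord
  | t : Coord
  | x (i : Fin 3) : Coord
  | y (i : Fin 3) : Coord

variable {k}

/-- The ideal of `k[s, t, x, y]` generated by the equations
`s x = P y × Q y`, `t y = ᵗP x × ᵗQ x`, `s t = (1/3) β^{PQ}(x, y)`, `ᵗx P y = 0`, `ᵗx Q y = 0`. -/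
noncomputable def idealPQ (P Q : Matrix (Fin 3) (Fin 3) k) : Ideal (MvPolynomial Coord k) :=
  let s : MvPolynomial Coord k := X Coord.s
  let t : MvPolynomial Coord k := X Coord.t
  let x : Fin 3 → MvPolynomial Coord k := fun i => X (Coord.x i)
  let y : Fin 3 → MvPolynomial Coord k := fun i => X (Coord.y i)
  let P' : Matrix (Fin 3) (Fin 3) (MvPolynomial Coord k) := P.map C
  let Q' : Matrix (Fin 3) (Fin 3) (MvPolynomial Coord k) := Q.map C
  Ideal.span
    (Set.range (fun i => s * x i - sharpY P' Q' y i) ∪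
      Set.range (fun i => t * y i - sharpX P' Q' x i) ∪
      {s * t - C (3 : k)⁻¹ * beta P' Q' x y, x ⬝ᵥ (P' *ᵥ y), x ⬝ᵥ (Q' *ᵥ y)})

/-- The affine scheme `R^{PQ}` over `k`. -/
noncomputable def schemePQ (P Q : Matrix (Fin 3) (Fin 3) k) : Over (Spec (CommRingCat.of k)) :=
  specOver k (MvPolynomial Coord k ⧸ idealPQ P Q)

/-- The vector with coordinates `a_i b_j c_l`. -/
def segreVec (a b c : Fin 2 → k) : Fin 2 × Fin 2 × Fin 2 → k :=
  fun i => a i.1 * b i.2.1 * c i.2.2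

theorem segreVec_ne_zero {a b c : Fin 2 → k} (ha : a ≠ 0) (hb : b ≠ 0) (hc : c ≠ 0) :
    segreVec a b c ≠ 0 := by
  obtain ⟨i, hi⟩ := Function.ne_iff.mp ha
  obtain ⟨j, hj⟩ := Function.ne_iff.mp hb
  obtain ⟨l, hl⟩ := Function.ne_iff.mp hc
  exact Function.ne_iff.mpr ⟨(i, j, l), mul_ne_zero (mul_ne_zero hi hj) hl⟩

/-- The Segre embedding `ℙ¹ × ℙ¹ × ℙ¹ → ℙ⁷`, `([a], [b], [c]) ↦ [a_i b_j c_l]`, on `k`-points;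
it does not depend on the representatives, see `segre_mk`. -/
noncomputable def segre (p : ℙ k (Fin 2 → k) × ℙ k (Fin 2 → k) × ℙ k (Fin 2 → k)) :
    ℙ k (Fin 2 × Fin 2 × Fin 2 → k) :=
  Projectivization.mk k (segreVec p.1.rep p.2.1.rep p.2.2.rep)
    (segreVec_ne_zero p.1.rep_nonzero p.2.1.rep_nonzero p.2.2.rep_nonzero)

theorem segre_mk {a b c : Fin 2 → k} (ha : a ≠ 0) (hb : b ≠ 0) (hc : c ≠ 0) :
    segre (Projectivization.mk k a ha, Projectivization.mk k b hb, Projectivization.mk k c hc) =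
      Projectivization.mk k (segreVec a b c) (segreVec_ne_zero ha hb hc) := by
  obtain ⟨u, hu⟩ := Projectivization.exists_smul_eq_mk_rep k a ha
  obtain ⟨v, hv⟩ := Projectivization.exists_smul_eq_mk_rep k b hb
  obtain ⟨w, hw⟩ := Projectivization.exists_smul_eq_mk_rep k c hc
  rw [segre, Projectivization.mk_eq_mk_iff]
  refine ⟨u * v * w, ?_⟩
  ext1 i
  simp only [← hu, ← hv, ← hw, segreVec, Pi.smul_apply, Units.smul_def, smul_eq_mul, Units.val_mul]
  ring

/-- The affine cone over a set of points of the projective space of `σ → k`, as a set of vectors: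
the union of the corresponding lines, together with the origin. -/
def coneSet {σ : Type} (Z : Set (ℙ k (σ → k))) : Set (σ → k) :=
  {v | ∀ hv : v ≠ 0, Projectivization.mk k v hv ∈ Z}

/-- The affine cone over a projective variety with set of `k`-points `Z`, for `k` algebraically
closed: the spectrum of the homogeneous coordinate ring, that is of the polynomial ring modulo the
ideal of all polynomials that vanish on the cone over `Z`. -/
noncomputable def affineCone {σ : Type} (Z : Set (ℙ k (σ → k))) :
    Over (Spec (CommRingCat.of k)) :=
  specOver k (MvPolynomial σ k ⧸ vanishingIdeal k (coneSet Z))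

end Schemes

end SegreFTS

/-! Nondegeneracy of `β` says that the pencil spanned by `P` and `Q` is equivalent to a diagonal one
with three distinct roots; for such a pencil the equations of `R^{PQ}` become, up to units, the nine
quadrics of the Segre cone.

Up to the factor `det U * det V`, the matrix of `β` transforms like the pencil under `(P, Q) ↦ (U P
V, U Q V)`, and it is unchanged by `P ↦ P + c Q`. Nondegeneracy makes some `P + c Q` invertible
(`exists_det_add_smul_ne_zero`), which reduces the pencil to `(1, M)`. There `β = -χ'(M)` for the
characteristic polynomial `χ` of `M`, so `D_β ≠ 0` forces simple eigenvalues. Hence `P = U diag(p)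
V`, `Q = U diag(q) V` with all entries of `d = p × q` nonzero (`exists_simultaneous_diagonal`).

For a diagonal pencil, put `x = d x'` and `t = (∏ dᵢ) t'`. The two bilinear equations say that the
vector `dᵢ x'ᵢ yᵢ` is orthogonal to `p` and `q`, hence that the `x'ᵢ yᵢ` are equal; as `3` is
invertible, the equation with `β` makes the common value `s t'` (`isSolution_diagonal_iff`). All
this holds for points in any `k`-algebra, so tautological points give mutually inverse maps of
coordinate rings (`nonempty_algEquiv`).

The cone is defined by the ideal of all polynomials vanishing on it. That the quadrics generate this
ideal is a straightening law: modulo them every monomial is a product over a chain in `{0, 1}³`,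
determined by its image under the parametrization (`vanishingIdeal_coneSet_segre`). -/

namespace SegreFTS

/-! ### Diagonalization of pencils with nondegenerate `β`. -/

section Diagonalization

variable {R : Type*} [CommRing R]

/-- Each term of `β` has the shape `A * B * C` with `B` built from adjugates. The outer factors of
the adjugates meet `U` and `V` and leave their determinants. -/
theorem betaMatrix_mul_mul (U V P Q : Matrix (Fin 3) (Fin 3) R) :
    betaMatrix (U * P * V) (U * Q * V) = (U.det * V.det) • (U * betaMatrix P Q * V) := by
  have key : ∀ A B C : Matrix (Fin 3) (Fin 3) R,
      (U * A * V) * (V.adjugate * B * U.adjugate) * (U * C * V) =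
        (U.det * V.det) • (U * (A * B * C) * V) := by
    intro A B C
    calc _ = U * A * (V * V.adjugate) * B * (U.adjugate * U) * C * V := by noncomm_ring
      _ = _ := by
        rw [Matrix.mul_adjugate, Matrix.adjugate_mul]
        simp [Matrix.mul_assoc, smul_smul]
  have hadj : ∀ A : Matrix (Fin 3) (Fin 3) R,
      (U * A * V).adjugate = V.adjugate * A.adjugate * U.adjugate := fun A => by
    rw [Matrix.adjugate_mul_distrib, Matrix.adjugate_mul_distrib, Matrix.mul_assoc]
  have hadd : U * P * V + U * Q * V = U * (P + Q) * V := by noncomm_ring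
  have hpol : V.adjugate * (P + Q).adjugate * U.adjugate - V.adjugate * P.adjugate * U.adjugate -
      V.adjugate * Q.adjugate * U.adjugate =
      V.adjugate * ((P + Q).adjugate - P.adjugate - Q.adjugate) * U.adjugate := by noncomm_ring
  rw [betaMatrix, hadd, hadj, hadj, hadj, hpol, key, key, key, betaMatrix, ← smul_sub, ← smul_sub,
    ← Matrix.sub_mul, ← Matrix.sub_mul, ← Matrix.mul_sub, ← Matrix.mul_sub]

theorem adjugate_add_smul (P Q : Matrix (Fin 3) (Fin 3) R) (c : R) :
    (P + c • Q).adjugate =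
      P.adjugate + c • ((P + Q).adjugate - P.adjugate - Q.adjugate) + c ^ 2 • Q.adjugate := by
  ext i j
  fin_cases i <;> fin_cases j <;>
  · simp [Matrix.adjugate_fin_three]
    ring

/-- The polarized adjugate `M` changes by `2c adj Q`. The terms `c Q M Q` cancel, and the rest are
multiples of `det Q` times `P` or `Q`, with coefficients summing to zero. -/
theorem betaMatrix_add_smul (P Q : Matrix (Fin 3) (Fin 3) R) (c : R) :
    betaMatrix (P + c • Q) Q = betaMatrix P Q := by
  have h1 : P + c • Q + Q = P + (c + 1) • Q := by rw [add_smul, one_smul, add_assoc]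
  have h2 : P * Q.adjugate * Q = Q.det • P := by
    rw [Matrix.mul_assoc, Matrix.adjugate_mul]; simp
  have h3 : Q * Q.adjugate = Q.det • 1 := Matrix.mul_adjugate Q
  rw [betaMatrix, h1, adjugate_add_smul, adjugate_add_smul, betaMatrix]
  generalize (P + Q).adjugate - P.adjugate - Q.adjugate = M
  have h4 : P.adjugate + (c + 1) • M + (c + 1) ^ 2 • Q.adjugate -
      (P.adjugate + c • M + c ^ 2 • Q.adjugate) - Q.adjugate = M + (2 * c) • Q.adjugate := by
    module
  rw [h4]
  simp only [Matrix.mul_add, Matrix.add_mul, Matrix.mul_smul, Matrix.smul_mul, h2, h3,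
    Matrix.one_mul]
  module

theorem det_add_smul (P Q : Matrix (Fin 3) (Fin 3) R) (c : R) :
    (P + c • Q).det = P.det + c * (P.adjugate * Q).trace + c ^ 2 * (P * Q.adjugate).trace +
      c ^ 3 * Q.det := by
  simp [Matrix.det_fin_three, Matrix.adjugate_fin_three, Matrix.trace, Fin.sum_univ_three,
    Matrix.mul_apply, Matrix.vecMul, dotProduct]
  ring

/-- This is the coefficient of `c` in `adj(P + c Q) (P + c Q) = det(P + c Q)`. -/
theorem adjugate_mul_add_polar_mul (P Q : Matrix (Fin 3) (Fin 3) R) :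
    P.adjugate * Q + ((P + Q).adjugate - P.adjugate - Q.adjugate) * P =
      (P.adjugate * Q).trace • 1 := by
  ext i j
  fin_cases i <;> fin_cases j <;>
  · simp [Matrix.adjugate_fin_three, Matrix.trace, Fin.sum_univ_three, Matrix.vecMul, dotProduct]
    ring

theorem betaMatrix_mulVec_of_mulVec_eq_zero {P Q : Matrix (Fin 3) (Fin 3) R} {y : Fin 3 → R}
    (hy : P *ᵥ y = 0) : betaMatrix P Q *ᵥ y = -(P.adjugate * Q).trace • (Q *ᵥ y) := by
  have h := congrArg (· *ᵥ y) (adjugate_mul_add_polar_mul P Q)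
  simp only [Matrix.add_mulVec, ← Matrix.mulVec_mulVec, hy, Matrix.mulVec_zero, add_zero,
    Matrix.smul_mulVec, Matrix.one_mulVec] at h
  -- In the transposed form of `β` the polar term ends in `P` and so kills `y`; only the term with
  -- `Q * P.adjugate * Q` survives.
  have ht : betaMatrix P Q = (betaMatrix Pᵀ Qᵀ)ᵀ := by
    rw [betaMatrix_transpose, Matrix.transpose_transpose]
  rw [ht, betaMatrix]
  simp only [Matrix.transpose_sub, Matrix.transpose_mul, Matrix.adjugate_transpose,
    ← Matrix.transpose_add, Matrix.transpose_transpose, Matrix.sub_mulVec,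
    ← Matrix.mulVec_mulVec, hy, Matrix.mulVec_zero, h, Matrix.mulVec_smul, neg_smul]
  simp

/-- The bracket is `χ'(M)`, by comparison with `eval_derivative_charpoly`. -/
theorem betaMatrix_one_left (M : Matrix (Fin 3) (Fin 3) R) :
    betaMatrix 1 M = -((3 : R) • (M * M) - (2 * M.trace) • M + M.adjugate.trace • 1) := by
  ext i j
  fin_cases i <;> fin_cases j <;>
  · simp [betaMatrix, Matrix.adjugate_fin_three, Matrix.trace, Fin.sum_univ_three,
      Matrix.mul_apply, Matrix.one_apply]
    ring

theorem eval_derivative_charpoly (M : Matrix (Fin 3) (Fin 3) R) (r : R) :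
    (Polynomial.derivative M.charpoly).eval r =
      3 * r ^ 2 - 2 * M.trace * r + M.adjugate.trace := by
  simp [Matrix.charpoly, Matrix.det_fin_three, Matrix.adjugate_fin_three, Matrix.trace,
    Fin.sum_univ_three, Polynomial.derivative_mul]
  ring

theorem betaMatrix_one_left_mulVec {M : Matrix (Fin 3) (Fin 3) R} {r : R} {v : Fin 3 → R}
    (hv : M *ᵥ v = r • v) :
    betaMatrix 1 M *ᵥ v = -(Polynomial.derivative M.charpoly).eval r • v := by
  rw [betaMatrix_one_left, eval_derivative_charpoly]
  simp only [Matrix.neg_mulVec, Matrix.add_mulVec, Matrix.sub_mulVec, Matrix.smul_mulVec,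
    ← Matrix.mulVec_mulVec, hv, Matrix.mulVec_smul, Matrix.one_mulVec]
  module

variable {k : Type*} [Field k]

/-- If `P` is singular, `β` maps a kernel vector `y` to `-tr(adj P Q) Q y`, so this trace is
nonzero. It is the linear coefficient of `det(P + c Q)`, a polynomial in `c` that therefore has a
non-root in the infinite field. -/
theorem exists_det_add_smul_ne_zero [Infinite k] {P Q : Matrix (Fin 3) (Fin 3) k}
    (hD : dBeta P Q ≠ 0) : ∃ c : k, (P + c • Q).det ≠ 0 := by
  by_cases hP : P.det = 0
  · have htr : (P.adjugate * Q).trace ≠ 0 := by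
      intro h0
      obtain ⟨y, hy0, hy⟩ := Matrix.exists_mulVec_eq_zero_iff.mpr hP
      refine hD (Matrix.exists_mulVec_eq_zero_iff.mp ⟨y, hy0, ?_⟩)
      rw [betaMatrix_mulVec_of_mulVec_eq_zero hy, h0, neg_zero, zero_smul]
    by_contra! hc
    apply htr
    have hp : (Polynomial.C (P.adjugate * Q).trace * Polynomial.X +
        Polynomial.C (P * Q.adjugate).trace * Polynomial.X ^ 2 +
        Polynomial.C Q.det * Polynomial.X ^ 3 : Polynomial k) = 0 := by
      refine Polynomial.funext fun c => ?_
      have h := hc c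
      rw [det_add_smul, hP] at h
      simp
      linear_combination h
    simpa [Polynomial.coeff_X, Polynomial.coeff_X_pow] using congrArg (Polynomial.coeff · 1) hp
  · exact ⟨0, by simpa using hP⟩

theorem exists_diagonal_of_det_betaMatrix_one_ne_zero [IsAlgClosed k]
    {M : Matrix (Fin 3) (Fin 3) k} (hM : (betaMatrix 1 M).det ≠ 0) :
    ∃ (S : Matrix (Fin 3) (Fin 3) k) (r : Fin 3 → k), IsUnit S ∧ Function.Injective r ∧
      M * S = S * Matrix.diagonal r := by
  classical
  have hne : M.charpoly ≠ 0 := M.charpoly_monic.ne_zero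
  have heig : ∀ r : k, M.charpoly.IsRoot r → ∃ v, v ≠ 0 ∧ M *ᵥ v = r • v := by
    intro r hr
    rw [Polynomial.IsRoot, Matrix.eval_charpoly] at hr
    obtain ⟨v, hv0, hv⟩ := Matrix.exists_mulVec_eq_zero_iff.mpr hr
    refine ⟨v, hv0, ?_⟩
    rw [Matrix.sub_mulVec, sub_eq_zero] at hv
    rw [← hv]
    simp
  -- At a multiple root `χ'` vanishes too, so an eigenvector would lie in the kernel of `β`.
  have hnodup : M.charpoly.roots.Nodup := by
    rw [Multiset.nodup_iff_count_le_one]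
    intro r
    rw [Polynomial.count_roots]
    by_contra! h
    rw [Polynomial.one_lt_rootMultiplicity_iff_isRoot hne] at h
    obtain ⟨v, hv0, hv⟩ := heig r h.1
    refine hM (Matrix.exists_mulVec_eq_zero_iff.mp ⟨v, hv0, ?_⟩)
    rw [betaMatrix_one_left_mulVec hv, h.2.eq_zero, neg_zero, zero_smul]
  have hcard : M.charpoly.roots.toFinset.card = 3 := by
    rw [Multiset.toFinset_card_of_nodup hnodup,
      Polynomial.splits_iff_card_roots.mp (IsAlgClosed.splits _), Matrix.charpoly_natDegree_eq_dim,
      Fintype.card_fin]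
  let e := (Finset.equivFinOfCardEq hcard).symm
  let r : Fin 3 → k := fun i => e i
  have hr : Function.Injective r := Subtype.val_injective.comp e.injective
  choose v hv0 hv using fun i => heig (r i)
    (Polynomial.isRoot_of_mem_roots (Multiset.mem_toFinset.mp (e i).2))
  refine ⟨(Matrix.of v)ᵀ, r, ?_, hr, ?_⟩
  · rw [← Matrix.linearIndependent_cols_iff_isUnit]
    refine Module.End.eigenvectors_linearIndependent' (Matrix.toLin' M) r hr v fun i => ?_
    exact Module.End.hasEigenvector_iff.mpr
      ⟨Module.End.mem_eigenspace_iff.mpr (by rw [Matrix.toLin'_apply, hv]), hv0 i⟩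
  · ext1 i j
    have h := congrFun (hv j) i
    rw [Matrix.mul_diagonal, Matrix.transpose_apply, Matrix.of_apply, mul_comm]
    exact h

/-- A pencil with nondegenerate `β` is equivalent to a diagonal pencil. -/
theorem exists_simultaneous_diagonal [IsAlgClosed k] {P Q : Matrix (Fin 3) (Fin 3) k}
    (hD : dBeta P Q ≠ 0) :
    ∃ (U V : Matrix (Fin 3) (Fin 3) k) (p q : Fin 3 → k), U.det ≠ 0 ∧ V.det ≠ 0 ∧
      P = U * Matrix.diagonal p * V ∧ Q = U * Matrix.diagonal q * V ∧
      ∀ i, crossProduct p q i ≠ 0 := by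
  have : Infinite k := IsAlgClosed.instInfinite
  obtain ⟨c, hc⟩ := exists_det_add_smul_ne_zero hD
  set A := P + c • Q with hA
  have hAu : IsUnit A.det := hc.isUnit
  have hQ : A * (A⁻¹ * Q) = Q := Matrix.mul_nonsing_inv_cancel_left A Q hAu
  have hM : (betaMatrix 1 (A⁻¹ * Q)).det ≠ 0 := by
    intro h0
    apply hD
    have h := betaMatrix_mul_mul A 1 1 (A⁻¹ * Q)
    rw [Matrix.mul_one, Matrix.mul_one, Matrix.mul_one, hQ, hA, betaMatrix_add_smul, ← hA] at h
    rw [dBeta, h, Matrix.det_smul, Matrix.det_mul, Matrix.det_mul, h0, mul_zero, zero_mul,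
      mul_zero]
  obtain ⟨S, r, hS, hr, hMS⟩ := exists_diagonal_of_det_betaMatrix_one_ne_zero hM
  have hSu : IsUnit S.det := (Matrix.isUnit_iff_isUnit_det S).mp hS
  have hQ' : Q = A * S * Matrix.diagonal r * S⁻¹ := by
    rw [Matrix.mul_assoc A, ← hMS, ← Matrix.mul_assoc A, hQ,
      Matrix.mul_nonsing_inv_cancel_right S Q hSu]
  have hA' : A = A * S * S⁻¹ := (Matrix.mul_nonsing_inv_cancel_right S A hSu).symm
  -- Since `P = A - c Q` and `A` corresponds to the identity, `p = 1 - c r` goes with `q = r`. The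
  -- constant `c` drops out of `p × q`, whose entries are differences of eigenvalues.
  refine ⟨A * S, S⁻¹, fun i => 1 - c * r i, r, ?_, ?_, ?_, hQ', ?_⟩
  · rw [Matrix.det_mul]
    exact mul_ne_zero hc hSu.ne_zero
  · rw [Matrix.det_nonsing_inv]
    exact hSu.ringInverse.ne_zero
  · have hdiag : Matrix.diagonal (fun i => 1 - c * r i) = 1 - c • Matrix.diagonal r := by
      rw [← Matrix.diagonal_one, ← Matrix.diagonal_smul, Matrix.diagonal_sub]
      rfl
    rw [hdiag, Matrix.mul_sub, Matrix.sub_mul, Matrix.mul_one, ← hA', Matrix.mul_smul,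
      Matrix.smul_mul, ← hQ', hA, add_sub_cancel_right]
  · have h01 := hr.ne (show (0 : Fin 3) ≠ 1 by decide)
    have h12 := hr.ne (show (1 : Fin 3) ≠ 2 by decide)
    have h20 := hr.ne (show (2 : Fin 3) ≠ 0 by decide)
    intro i
    fin_cases i
    · rw [show crossProduct (fun i => 1 - c * r i) r ⟨0, _⟩ = r 2 - r 1 by
        simp [crossProduct]; ring]
      exact sub_ne_zero.mpr h12.symm
    · rw [show crossProduct (fun i => 1 - c * r i) r ⟨1, _⟩ = r 0 - r 2 by
        simp [crossProduct]; ring]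
      exact sub_ne_zero.mpr h20.symm
    · rw [show crossProduct (fun i => 1 - c * r i) r ⟨2, _⟩ = r 1 - r 0 by
        simp [crossProduct]; ring]
      exact sub_ne_zero.mpr h01.symm

end Diagonalization

/-! ### The ideal of the Segre cone and the straightening law. -/

section SegreIdeal

open MvPolynomial

/-- The quadratic relations `z_u z_v = z_{u ∨ v} z_{u ∧ v}` of the Segre variety, where `u, v` run
over the distributive lattice `{0, 1}³`. -/
def SegreRel {R : Type*} [CommRing R] (z : Fin 2 × Fin 2 × Fin 2 → R) : Prop :=
  ∀ u v, z u * z v = z (u ⊔ v) * z (u ⊓ v)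

/-- The index `1` if `a > 0`, and `0` otherwise. -/
def posIndex (a : ℕ) : Fin 2 := if a = 0 then 0 else 1

/-- The product of the `d` elements of the chain in `{0, 1}³` whose sum is `(a, b, c)`. -/
def chainProd {R : Type*} [CommRing R] (z : Fin 2 × Fin 2 × Fin 2 → R) : ℕ → ℕ → ℕ → ℕ → R
  | 0, _, _, _ => 1
  | d + 1, a, b, c =>
    z (posIndex a, posIndex b, posIndex c) * chainProd z d (a - 1) (b - 1) (c - 1)

theorem posIndex_add (a : ℕ) (i : Fin 2) : posIndex (a + i) = i ⊔ posIndex a := by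
  fin_cases i <;> by_cases h : a = 0 <;> simp [posIndex, h]

theorem sub_one_add_inf_posIndex (a : ℕ) (i : Fin 2) :
    a - 1 + ((i ⊓ posIndex a : Fin 2) : ℕ) = a + i - 1 := by
  fin_cases i <;> by_cases h : a = 0 <;> simp [posIndex, h]
  omega

/-- Insertion of a factor into a chain: with `v` the top of the chain, `z u * z v` is replaced by `z
(u ⊔ v) * z (u ⊓ v)`. The join is the new top, and the meet is inserted into the shorter chain by
induction. The bounds ensure that the truncated subtractions lose nothing. -/
theorem SegreRel.mul_chainProd {R : Type*} [CommRing R] {z : Fin 2 × Fin 2 × Fin 2 → R}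
    (hz : SegreRel z) (d : ℕ) : ∀ (a b c : ℕ) (u : Fin 2 × Fin 2 × Fin 2), a ≤ d → b ≤ d → c ≤ d →
      z u * chainProd z d a b c = chainProd z (d + 1) (a + u.1) (b + u.2.1) (c + u.2.2) := by
  induction d with
  | zero =>
    rintro a b c ⟨i, j, l⟩ ha hb hc
    obtain rfl : a = 0 := by omega
    obtain rfl : b = 0 := by omega
    obtain rfl : c = 0 := by omega
    have h : ∀ i : Fin 2, posIndex i = i := by decide
    simp [chainProd, h]
  | succ d ih =>
    rintro a b c ⟨i, j, l⟩ ha hb hc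
    rw [chainProd, ← mul_assoc, hz, mul_assoc, ih _ _ _ _ (by omega) (by omega) (by omega),
      chainProd.eq_2 z _ _ _ (d + 1), posIndex_add, posIndex_add, posIndex_add,
      ← sub_one_add_inf_posIndex a, ← sub_one_add_inf_posIndex b, ← sub_one_add_inf_posIndex c]
    rfl

variable (k : Type*) [Field k]

/-- The ideal generated by the quadratic relations of the Segre variety. -/
noncomputable def segreIdeal : Ideal (MvPolynomial (Fin 2 × Fin 2 × Fin 2) k) :=
  Ideal.span (Set.range fun w : (Fin 2 × Fin 2 × Fin 2) × (Fin 2 × Fin 2 × Fin 2) =>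
    X w.1 * X w.2 - X (w.1 ⊔ w.2) * X (w.1 ⊓ w.2))

theorem segreRel_mk_X {I : Ideal (MvPolynomial (Fin 2 × Fin 2 × Fin 2) k)}
    (hI : segreIdeal k ≤ I) : SegreRel fun u => Ideal.Quotient.mk I (X u) := by
  intro u v
  rw [← map_mul, ← map_mul, Ideal.Quotient.eq]
  exact hI (Ideal.subset_span ⟨(u, v), rfl⟩)

/-- The exponent vector of the monomial `w a^i b^j c^l`. -/
noncomputable def segreExponent (u : Fin 2 × Fin 2 × Fin 2) : Fin 4 →₀ ℕ :=
  Finsupp.equivFunOnFinite.symm ![1, u.1, u.2.1, u.2.2]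

/-- The parametrization `z_{ijl} ↦ w a^i b^j c^l` of the cone over the Segre variety. -/
noncomputable def segreParam :
    MvPolynomial (Fin 2 × Fin 2 × Fin 2) k →ₐ[k] MvPolynomial (Fin 4) k :=
  aeval fun u => monomial (segreExponent u) 1

/-- The linear map which takes a monomial `w^d a^α b^β c^γ` to the class of the product of the
chain of length `d` with sum `(α, β, γ)`. -/
noncomputable def chainMap :
    MvPolynomial (Fin 4) k →ₗ[k] MvPolynomial (Fin 2 × Fin 2 × Fin 2) k ⧸ segreIdeal k :=
  (basisMonomials (Fin 4) k).constr k fun e =>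
    chainProd (fun u => Ideal.Quotient.mk (segreIdeal k) (X u)) (e 0) (e 1) (e 2) (e 3)

theorem chainMap_monomial (e : Fin 4 →₀ ℕ) :
    chainMap k (monomial e 1) =
      chainProd (fun u => Ideal.Quotient.mk (segreIdeal k) (X u)) (e 0) (e 1) (e 2) (e 3) := by
  have h := (basisMonomials (Fin 4) k).constr_basis k (fun e =>
    chainProd (fun u => Ideal.Quotient.mk (segreIdeal k) (X u)) (e 0) (e 1) (e 2) (e 3)) e
  rwa [coe_basisMonomials] at h

/-- Straightening of monomials, one variable at a time. The bounds by the degree `e 0` are carried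
along because each insertion needs them. -/
theorem exists_segreParam_monomial (m : Fin 2 × Fin 2 × Fin 2 →₀ ℕ) :
    ∃ e : Fin 4 →₀ ℕ, segreParam k (monomial m 1) = monomial e 1 ∧
      e 1 ≤ e 0 ∧ e 2 ≤ e 0 ∧ e 3 ≤ e 0 ∧ Ideal.Quotient.mk (segreIdeal k) (monomial m 1) =
      chainProd (fun u => Ideal.Quotient.mk (segreIdeal k) (X u)) (e 0) (e 1) (e 2) (e 3) := by
  obtain ⟨s, rfl⟩ := Multiset.toFinsupp.surjective m
  induction s using Multiset.induction_on with
  | empty => exact ⟨0, by simp [chainProd]⟩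
  | cons u s ih =>
    obtain ⟨e, he, h1, h2, h3, h⟩ := ih
    have hs : (monomial (Multiset.toFinsupp (u ::ₘ s)) (1 : k)) =
        X u * monomial (Multiset.toFinsupp s) 1 := by
      rw [← Multiset.singleton_add, map_add, Multiset.toFinsupp_singleton, X, monomial_mul, one_mul]
    have hu := u.1.isLt
    have hv := u.2.1.isLt
    have hw := u.2.2.isLt
    refine ⟨e + segreExponent u, ?_, ?_, ?_, ?_, ?_⟩
    · rw [hs, map_mul, he, segreParam, aeval_X, monomial_mul, one_mul, add_comm]
    · simp [segreExponent]; omega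
    · simp [segreExponent]; omega
    · simp [segreExponent]; omega
    · rw [hs, map_mul, h, (segreRel_mk_X k le_rfl).mul_chainProd _ _ _ _ _ h1 h2 h3]
      simp [segreExponent]

/-- Hence the kernel of the parametrization lies in the ideal of quadrics. -/
theorem chainMap_segreParam (f : MvPolynomial (Fin 2 × Fin 2 × Fin 2) k) :
    chainMap k (segreParam k f) = Ideal.Quotient.mk (segreIdeal k) f := by
  have h : (chainMap k).comp (segreParam k).toLinearMap =
      (Ideal.Quotient.mkₐ k (segreIdeal k)).toLinearMap := by
    refine (basisMonomials _ k).ext fun m => ?_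
    obtain ⟨e, he, -, -, -, h⟩ := exists_segreParam_monomial k m
    simp only [coe_basisMonomials, LinearMap.comp_apply, AlgHom.toLinearMap_apply, he,
      chainMap_monomial]
    exact h.symm
  exact LinearMap.congr_fun h f

variable {k}

theorem segreVec_mem_coneSet (a b c : Fin 2 → k) :
    segreVec a b c ∈ coneSet (Set.range (segre (k := k))) := by
  intro hv
  have ha : a ≠ 0 := by rintro rfl; exact hv (by ext; simp [segreVec])
  have hb : b ≠ 0 := by rintro rfl; exact hv (by ext; simp [segreVec])
  have hc : c ≠ 0 := by rintro rfl; exact hv (by ext; simp [segreVec])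
  exact ⟨_, segre_mk ha hb hc⟩

theorem exists_segreVec_of_mem_coneSet {v : Fin 2 × Fin 2 × Fin 2 → k}
    (hv : v ∈ coneSet (Set.range (segre (k := k)))) : ∃ a b c, v = segreVec a b c := by
  by_cases h0 : v = 0
  · exact ⟨0, 0, 0, by ext; simp [segreVec, h0]⟩
  · obtain ⟨⟨p, q, r⟩, h⟩ := hv h0
    rw [segre, Projectivization.mk_eq_mk_iff'] at h
    obtain ⟨t, ht⟩ := h
    by_cases ht0 : t = 0
    · rw [ht0, zero_smul] at ht
      exact absurd ht.symm (segreVec_ne_zero p.rep_nonzero q.rep_nonzero r.rep_nonzero)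
    -- The scalar between the two representatives is absorbed into the first factor.
    · refine ⟨t⁻¹ • p.rep, q.rep, r.rep, ?_⟩
      ext1 i
      have hi := congrFun ht i
      simp only [segreVec, Pi.smul_apply, smul_eq_mul] at hi ⊢
      rw [mul_assoc t⁻¹, mul_assoc t⁻¹, ← hi, inv_mul_cancel_left₀ ht0]

theorem vanishingIdeal_coneSet_segre [Infinite k] :
    vanishingIdeal k (coneSet (Set.range (segre (k := k)))) = segreIdeal k := by
  apply le_antisymm
  · intro f hf
    rw [mem_vanishingIdeal_iff] at hf
    have h0 : segreParam k f = 0 := by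
      refine MvPolynomial.funext fun w => ?_
      -- These points form the chart with parameters `(w, a, b, c)` on which `segreParam` is
      -- evaluation; over an infinite field they suffice to make `segreParam k f` vanish.
      have h := hf _ (segreVec_mem_coneSet ![w 0, w 0 * w 1] ![1, w 2] ![1, w 3])
      have hc : ((aeval w).comp (segreParam k) : _ →ₐ[k] k) =
          aeval (segreVec ![w 0, w 0 * w 1] ![1, w 2] ![1, w 3]) := by
        refine algHom_ext fun u => ?_
        obtain ⟨i, j, l⟩ := u
        rw [AlgHom.comp_apply, segreParam, aeval_X, aeval_X, aeval_monomial, segreExponent,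
          Finsupp.prod_fintype _ _ (by simp), Fin.prod_univ_four]
        fin_cases i <;> fin_cases j <;> fin_cases l <;> simp [segreVec]
      rw [← hc, AlgHom.comp_apply] at h
      rw [map_zero]
      exact h
    rw [← Ideal.Quotient.eq_zero_iff_mem, ← chainMap_segreParam, h0, map_zero]
  · rw [segreIdeal, Ideal.span_le]
    rintro _ ⟨⟨u, v⟩, rfl⟩
    rw [SetLike.mem_coe, mem_vanishingIdeal_iff]
    intro x hx
    obtain ⟨a, b, c, rfl⟩ := exists_segreVec_of_mem_coneSet hx
    -- In the chain `{0, 1}`, join and meet merely permute the two indices.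
    have h : ∀ (a : Fin 2 → k) (i j : Fin 2), a (i ⊔ j) * a (i ⊓ j) = a i * a j := by
      intro a i j
      fin_cases i <;> fin_cases j <;> simp [mul_comm]
    simp only [map_sub, map_mul, aeval_X, segreVec, Prod.fst_sup, Prod.snd_sup, Prod.fst_inf,
      Prod.snd_inf]
    linear_combination (-(b (u.2.1 ⊔ v.2.1) * b (u.2.1 ⊓ v.2.1) * (c (u.2.2 ⊔ v.2.2) *
      c (u.2.2 ⊓ v.2.2)))) * h a u.1 v.1 - a u.1 * a v.1 * (c (u.2.2 ⊔ v.2.2) *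
      c (u.2.2 ⊓ v.2.2)) * h b u.2.1 v.2.1 - a u.1 * a v.1 * (b u.2.1 * b v.2.1) *
      h c u.2.2 v.2.2

end SegreIdeal

/-! ### The equations at ring-valued points, and their reduction to the Segre quadrics. -/

section Solutions

variable {R : Type*} [CommRing R]

/-- The equations of `R^{PQ}` for a point with values in `R`. -/
def IsSolution (P Q : Matrix (Fin 3) (Fin 3) R) (s t : R) (x y : Fin 3 → R) : Prop :=
  s • x = sharpY P Q y ∧ t • y = sharpX P Q x ∧ 3 * (s * t) = beta P Q x y ∧
    x ⬝ᵥ (P *ᵥ y) = 0 ∧ x ⬝ᵥ (Q *ᵥ y) = 0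

/-- A cross product of images under `U` is the cofactor matrix of `U` applied to the cross product;
applying `Uᵀ` turns this into `det U`, which cancels. -/
theorem smul_eq_sharpY_mul_mul_iff {U : Matrix (Fin 3) (Fin 3) R} (hU : IsUnit U.det)
    (V P Q : Matrix (Fin 3) (Fin 3) R) (s : R) (x y : Fin 3 → R) :
    (U.det * s) • x = sharpY (U * P * V) (U * Q * V) y ↔
      s • (Uᵀ *ᵥ x) = sharpY P Q (V *ᵥ y) := by
  have h : sharpY (U * P * V) (U * Q * V) y = U.adjugateᵀ *ᵥ sharpY P Q (V *ᵥ y) := by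
    rw [sharpY, sharpY, adjugate_transpose_mulVec_cross]
    simp only [Matrix.mulVec_mulVec, Matrix.mul_assoc]
  have hinj : Function.Injective (Uᵀ *ᵥ ·) :=
    Matrix.mulVec_injective_of_isUnit
      ((Matrix.isUnit_iff_isUnit_det _).mpr (by rwa [Matrix.det_transpose]))
  rw [h, ← hinj.eq_iff, ← hU.smul_left_cancel (x := s • (Uᵀ *ᵥ x))]
  simp only [Matrix.mulVec_mulVec, ← Matrix.transpose_mul, Matrix.adjugate_mul,
    Matrix.mulVec_smul, Matrix.transpose_smul, Matrix.transpose_one, Matrix.smul_mulVec,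
    Matrix.one_mulVec, smul_smul]

theorem isSolution_mul_mul_iff {U V : Matrix (Fin 3) (Fin 3) R} (hU : IsUnit U.det)
    (hV : IsUnit V.det) (P Q : Matrix (Fin 3) (Fin 3) R) (s t : R) (x y : Fin 3 → R) :
    IsSolution (U * P * V) (U * Q * V) (U.det * s) (V.det * t) x y ↔
      IsSolution P Q s t (Uᵀ *ᵥ x) (V *ᵥ y) := by
  have hX : (V.det * t) • y = sharpX (U * P * V) (U * Q * V) x ↔
      t • (V *ᵥ y) = sharpX P Q (Uᵀ *ᵥ x) := by
    have h := smul_eq_sharpY_mul_mul_iff (U := Vᵀ) (by rwa [Matrix.det_transpose]) Uᵀ Pᵀ Qᵀ t y x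
    simpa only [sharpX_eq, Matrix.transpose_mul, Matrix.mul_assoc, Matrix.det_transpose,
      Matrix.transpose_transpose] using h
  have hdot : ∀ A : Matrix (Fin 3) (Fin 3) R,
      x ⬝ᵥ ((U * A * V) *ᵥ y) = (Uᵀ *ᵥ x) ⬝ᵥ (A *ᵥ (V *ᵥ y)) := fun A => by
    rw [dotProduct_transpose_mulVec, Matrix.mulVec_mulVec, Matrix.mulVec_mulVec, Matrix.mul_assoc]
  have hb : 3 * (U.det * s * (V.det * t)) = beta (U * P * V) (U * Q * V) x y ↔
      3 * (s * t) = beta P Q (Uᵀ *ᵥ x) (V *ᵥ y) := by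
    rw [beta, betaMatrix_mul_mul, Matrix.smul_mulVec, dotProduct_smul, hdot, smul_eq_mul,
      ← (hU.mul hV).mul_right_inj (b := 3 * (s * t)), beta]
    ring_nf
  rw [IsSolution, IsSolution, smul_eq_sharpY_mul_mul_iff hU, hX, hb, hdot, hdot]

/-- The vector `z` with `z₀₀₀ = s`, `z₁₁₁ = t`, `z₀₁₁, z₁₀₁, z₁₁₀ = x` and
`z₁₀₀, z₀₁₀, z₀₀₁ = y`. -/
def segreCoord (s t : R) (x y : Fin 3 → R) (u : Fin 2 × Fin 2 × Fin 2) : R :=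
  ![![![s, y 2], ![y 1, x 0]], ![![y 0, x 1], ![x 2, t]]] u.1 u.2.1 u.2.2

/-- Only incomparable pairs in `{0, 1}³` give nontrivial relations: six from the diagonals of the
faces of the cube, and three equating the products of antipodal pairs. -/
theorem segreRel_segreCoord_iff (s t : R) (x y : Fin 3 → R) :
    SegreRel (segreCoord s t x y) ↔
      (s * x 0 = y 1 * y 2 ∧ s * x 1 = y 2 * y 0 ∧ s * x 2 = y 0 * y 1) ∧
      (t * y 0 = x 1 * x 2 ∧ t * y 1 = x 2 * x 0 ∧ t * y 2 = x 0 * x 1) ∧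
      (x 0 * y 0 = s * t ∧ x 1 * y 1 = s * t ∧ x 2 * y 2 = s * t) := by
  constructor
  · intro h
    have h1 := h (0, 1, 0) (0, 0, 1)
    have h2 := h (0, 0, 1) (1, 0, 0)
    have h3 := h (1, 0, 0) (0, 1, 0)
    have h4 := h (1, 0, 1) (1, 1, 0)
    have h5 := h (1, 1, 0) (0, 1, 1)
    have h6 := h (0, 1, 1) (1, 0, 1)
    have h7 := h (0, 1, 1) (1, 0, 0)
    have h8 := h (1, 0, 1) (0, 1, 0)
    have h9 := h (1, 1, 0) (0, 0, 1)
    simp [segreCoord] at h1 h2 h3 h4 h5 h6 h7 h8 h9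
    refine ⟨⟨?_, ?_, ?_⟩, ⟨?_, ?_, ?_⟩, ?_, ?_, ?_⟩
    · rw [h1, mul_comm]
    · rw [h2, mul_comm]
    · rw [h3, mul_comm]
    · rw [h4]
    · rw [h5]
    · rw [h6]
    · rw [h7, mul_comm]
    · rw [h8, mul_comm]
    · rw [h9, mul_comm]
  · rintro ⟨⟨h1, h2, h3⟩, ⟨h4, h5, h6⟩, h7, h8, h9⟩
    simp only [SegreRel, Prod.forall, Fin.forall_fin_two, Prod.mk_sup_mk, Prod.mk_inf_mk]
    simp [segreCoord]
    grind

theorem isSolution_diagonal_iff (h3 : IsUnit (3 : R)) {p q : Fin 3 → R}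
    (hd : ∀ i, IsUnit (crossProduct p q i)) (s t : R) (x y : Fin 3 → R) :
    IsSolution (Matrix.diagonal p) (Matrix.diagonal q) s ((∏ i, crossProduct p q i) * t)
      (crossProduct p q * x) y ↔ SegreRel (segreCoord s t x y) := by
  have hβ : betaMatrix (Matrix.diagonal p) (Matrix.diagonal q) =
      Matrix.diagonal ![crossProduct p q 1 * crossProduct p q 2,
        crossProduct p q 2 * crossProduct p q 0, crossProduct p q 0 * crossProduct p q 1] := by
    have h0 : Finset.univ.erase (0 : Fin 3) = {1, 2} := by decide
    have h1 : Finset.univ.erase (1 : Fin 3) = {0, 2} := by decide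
    have h2 : Finset.univ.erase (2 : Fin 3) = {0, 1} := by decide
    simp only [betaMatrix, Matrix.adjugate_diagonal, Matrix.diagonal_add, Matrix.diagonal_sub,
      Matrix.diagonal_mul_diagonal]
    congr 1
    ext i
    fin_cases i <;>
    · simp [crossProduct, h0, h1, h2]
      ring
  have hp : p ⬝ᵥ crossProduct p q = 0 := dot_self_cross p q
  have hq : q ⬝ᵥ crossProduct p q = 0 := dot_cross_self p q
  have hY : sharpY (Matrix.diagonal p) (Matrix.diagonal q) y =
      crossProduct p q * ![y 1 * y 2, y 2 * y 0, y 0 * y 1] := by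
    ext i
    fin_cases i <;>
    · simp [sharpY, crossProduct, Matrix.mulVec_diagonal]
      ring
  have hX : sharpX (Matrix.diagonal p) (Matrix.diagonal q) (crossProduct p q * x) =
      (∏ i, crossProduct p q i) • ![x 1 * x 2, x 2 * x 0, x 0 * x 1] := by
    ext i
    fin_cases i <;>
    · simp [sharpX, crossProduct, Matrix.mulVec_diagonal, Fin.prod_univ_three]
      ring
  have hdef : crossProduct p q =
      ![p 1 * q 2 - p 2 * q 1, p 2 * q 0 - p 0 * q 2, p 0 * q 1 - p 1 * q 0] := rfl
  rw [segreRel_segreCoord_iff, IsSolution, beta, hβ, hY, hX]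
  set d := crossProduct p q
  have hD : IsUnit (∏ i, d i) := by
    rw [Fin.prod_univ_three]
    exact ((hd 0).mul (hd 1)).mul (hd 2)
  refine and_congr ?_ (and_congr ?_ ?_)
  · rw [funext_iff, Fin.forall_fin_succ, Fin.forall_fin_succ, Fin.forall_fin_succ]
    simp only [Pi.smul_apply, Pi.mul_apply, smul_eq_mul, mul_left_comm s]
    simp [(hd _).mul_right_inj]
  · rw [mul_smul, hD.smul_left_cancel, funext_iff, Fin.forall_fin_succ, Fin.forall_fin_succ,
      Fin.forall_fin_succ]
    simp
  · simp only [dotProduct, Matrix.mulVec_diagonal, Fin.sum_univ_three, Pi.mul_apply,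
      Fin.prod_univ_three] at hp hq ⊢
    simp only [Matrix.cons_val]
    have e0 : d 0 = p 1 * q 2 - p 2 * q 1 := congrFun hdef 0
    have e1 : d 1 = p 2 * q 0 - p 0 * q 2 := congrFun hdef 1
    have e2 : d 2 = p 0 * q 1 - p 1 * q 0 := congrFun hdef 2
    constructor
    · rintro ⟨hst, hP, hQ⟩
      -- Eliminating `x 2 * y 2` between the two bilinear equations leaves `d 0 * d 1 * (x 0 * y 0 -
      -- x 1 * y 1) = 0`.
      have h01 : x 0 * y 0 = x 1 * y 1 := by
        apply ((hd 0).mul (hd 1)).mul_right_inj.mp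
        linear_combination p 2 * hQ - q 2 * hP + d 0 * x 0 * y 0 * e1 - d 1 * x 1 * y 1 * e0
      have h12 : x 1 * y 1 = x 2 * y 2 := by
        apply ((hd 1).mul (hd 2)).mul_right_inj.mp
        linear_combination p 0 * hQ - q 0 * hP + d 1 * x 1 * y 1 * e2 - d 2 * x 2 * y 2 * e1
      have h0 : x 0 * y 0 = s * t := by
        apply (h3.mul (((hd 0).mul (hd 1)).mul (hd 2))).mul_right_inj.mp
        linear_combination -hst + d 0 * d 1 * d 2 * (2 * h01 + h12)
      exact ⟨h0, h01 ▸ h0, h12 ▸ h01 ▸ h0⟩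
    · rintro ⟨h0, h1, h2⟩
      refine ⟨?_, ?_, ?_⟩
      · linear_combination -(d 0 * d 1 * d 2) * (h0 + h1 + h2)
      · linear_combination d 0 * p 0 * h0 + d 1 * p 1 * h1 + d 2 * p 2 * h2 + s * t * hp
      · linear_combination d 0 * q 0 * h0 + d 1 * q 1 * h1 + d 2 * q 2 * h2 + s * t * hq

end Solutions

/-! ### The isomorphism of coordinate rings and of schemes. -/

section Isomorphism

open MvPolynomial

variable {k : Type*} [Field k] {R S : Type*} [CommRing R] [Algebra k R] [CommRing S] [Algebra k S]

theorem sharpY_map {A B : Type*} [CommRing A] [CommRing B] (f : A →+* B)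
    (P Q : Matrix (Fin 3) (Fin 3) A) (y : Fin 3 → A) :
    f ∘ sharpY P Q y = sharpY (P.map f) (Q.map f) (f ∘ y) :=
  sharpX_map f Pᵀ Qᵀ y

theorem map_dotProduct_mulVec {A B : Type*} [CommRing A] [CommRing B] (f : A →+* B)
    (M : Matrix (Fin 3) (Fin 3) A) (x y : Fin 3 → A) :
    f (x ⬝ᵥ (M *ᵥ y)) = (f ∘ x) ⬝ᵥ (M.map f *ᵥ (f ∘ y)) := by
  simp [Matrix.mulVec, dotProduct, Fin.sum_univ_three]

/-- The equations of `R^{PQ}` hold for an `R`-valued point iff the ideal maps to zero. -/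
theorem idealPQ_le_ker_iff (h3 : (3 : k) ≠ 0) (P Q : Matrix (Fin 3) (Fin 3) k)
    (g : MvPolynomial Coord k →ₐ[k] R) :
    idealPQ P Q ≤ RingHom.ker g ↔
      IsSolution (P.map (algebraMap k R)) (Q.map (algebraMap k R)) (g (X Coord.s)) (g (X Coord.t))
        (fun i => g (X (Coord.x i))) (fun i => g (X (Coord.y i))) := by
  have hmap : ∀ M : Matrix (Fin 3) (Fin 3) k,
      (M.map (C (σ := Coord))).map (g : MvPolynomial Coord k →+* R) = M.map (algebraMap k R) := by
    intro M
    ext1 i j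
    exact g.commutes (M i j)
  have hY : ∀ i, g (sharpY (P.map C) (Q.map C) (fun i => X (Coord.y i)) i) =
      sharpY (P.map (algebraMap k R)) (Q.map (algebraMap k R)) (fun i => g (X (Coord.y i))) i := by
    intro i
    rw [← hmap P, ← hmap Q]
    exact congrFun (sharpY_map (g : MvPolynomial Coord k →+* R) _ _ _) i
  have hX : ∀ i, g (sharpX (P.map C) (Q.map C) (fun i => X (Coord.x i)) i) =
      sharpX (P.map (algebraMap k R)) (Q.map (algebraMap k R)) (fun i => g (X (Coord.x i))) i := by
    intro i
    rw [← hmap P, ← hmap Q]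
    exact congrFun (sharpX_map (g : MvPolynomial Coord k →+* R) _ _ _) i
  have hdot : ∀ M : Matrix (Fin 3) (Fin 3) (MvPolynomial Coord k),
      g ((fun i => X (Coord.x i)) ⬝ᵥ (M *ᵥ fun i => X (Coord.y i))) =
        (fun i => g (X (Coord.x i))) ⬝ᵥ (M.map (g : MvPolynomial Coord k →+* R) *ᵥ
          fun i => g (X (Coord.y i))) :=
    fun M => map_dotProduct_mulVec (g : MvPolynomial Coord k →+* R) M _ _
  have hβ : g (beta (P.map C) (Q.map C) (fun i => X (Coord.x i)) (fun i => X (Coord.y i))) =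
      beta (P.map (algebraMap k R)) (Q.map (algebraMap k R)) (fun i => g (X (Coord.x i)))
        (fun i => g (X (Coord.y i))) := by
    rw [beta, hdot, ← betaMatrix_map, hmap, hmap, beta]
  have h3R : algebraMap k R 3⁻¹ * 3 = 1 := by
    rw [← map_ofNat (algebraMap k R) 3, ← map_mul, inv_mul_cancel₀ h3, map_one]
  have hC : g (C 3⁻¹) = algebraMap k R 3⁻¹ := g.commutes _
  have hst : ∀ a b : R, a = algebraMap k R 3⁻¹ * b ↔ 3 * a = b := by
    refine fun a b => ⟨fun h => ?_, fun h => ?_⟩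
    · linear_combination 3 * h + b * h3R
    · linear_combination algebraMap k R 3⁻¹ * h - a * h3R
  simp only [idealPQ, Ideal.span_le, Set.union_subset_iff, Set.range_subset_iff,
    Set.insert_subset_iff, Set.singleton_subset_iff, SetLike.mem_coe, RingHom.mem_ker, map_sub,
    map_mul, sub_eq_zero, hY, hX, hβ, hdot, hmap, hC, hst, IsSolution, funext_iff, Pi.smul_apply,
    smul_eq_mul, and_assoc]

/-- The coordinates `(s, t, x, y)` of the point of `R^{PQ}` which corresponds to the point `z` of
the cone over the Segre variety, for `P = U diag(p) V`, `Q = U diag(q) V` and `d = p × q`. -/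
noncomputable def coordOfSegre (U V : Matrix (Fin 3) (Fin 3) k) (d : Fin 3 → k)
    (z : Fin 2 × Fin 2 × Fin 2 → R) : Coord → R
  | Coord.s => algebraMap k R U.det * z (0, 0, 0)
  | Coord.t => algebraMap k R V.det * ((∏ i, algebraMap k R (d i)) * z (1, 1, 1))
  | Coord.x i => ((U⁻¹)ᵀ.map (algebraMap k R) *ᵥ
      ((algebraMap k R ∘ d) * ![z (0, 1, 1), z (1, 0, 1), z (1, 1, 0)])) i
  | Coord.y i => ((V⁻¹).map (algebraMap k R) *ᵥ ![z (1, 0, 0), z (0, 1, 0), z (0, 0, 1)]) i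

/-- The inverse of `coordOfSegre`. -/
noncomputable def segreOfCoord (U V : Matrix (Fin 3) (Fin 3) k) (d : Fin 3 → k) (f : Coord → R) :
    Fin 2 × Fin 2 × Fin 2 → R :=
  segreCoord (algebraMap k R U.det⁻¹ * f Coord.s)
    (algebraMap k R (V.det⁻¹ * (∏ i, d i)⁻¹) * f Coord.t)
    ((algebraMap k R ∘ d⁻¹) * (Uᵀ.map (algebraMap k R) *ᵥ fun i => f (Coord.x i)))
    (V.map (algebraMap k R) *ᵥ fun i => f (Coord.y i))

theorem map_coordOfSegre (g : R →ₐ[k] S) (U V : Matrix (Fin 3) (Fin 3) k) (d : Fin 3 → k)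
    (z : Fin 2 × Fin 2 × Fin 2 → R) (c : Coord) :
    g (coordOfSegre U V d z c) = coordOfSegre U V d (g ∘ z) c := by
  cases c with
  | s => simp [coordOfSegre]
  | t => simp [coordOfSegre]
  | x i => simp [coordOfSegre, Matrix.mulVec, dotProduct, Fin.sum_univ_three]
  | y i => simp [coordOfSegre, Matrix.mulVec, dotProduct, Fin.sum_univ_three]

theorem map_segreOfCoord (g : R →ₐ[k] S) (U V : Matrix (Fin 3) (Fin 3) k) (d : Fin 3 → k)
    (f : Coord → R) (u : Fin 2 × Fin 2 × Fin 2) :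
    g (segreOfCoord U V d f u) = segreOfCoord U V d (g ∘ f) u := by
  obtain ⟨i, j, l⟩ := u
  fin_cases i <;> fin_cases j <;> fin_cases l <;>
    simp [segreOfCoord, segreCoord, Matrix.mulVec, dotProduct, Fin.sum_univ_three]

theorem segreCoord_self {α : Type*} (z : Fin 2 × Fin 2 × Fin 2 → α) :
    segreCoord (z (0, 0, 0)) (z (1, 1, 1)) ![z (0, 1, 1), z (1, 0, 1), z (1, 1, 0)]
      ![z (1, 0, 0), z (0, 1, 0), z (0, 0, 1)] = z := by
  ext1 ⟨i, j, l⟩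
  fin_cases i <;> fin_cases j <;> fin_cases l <;> rfl

theorem map_mulVec_map_mulVec_of_mul_eq_one {A B : Matrix (Fin 3) (Fin 3) k} (h : A * B = 1)
    (v : Fin 3 → R) : A.map (algebraMap k R) *ᵥ (B.map (algebraMap k R) *ᵥ v) = v := by
  rw [Matrix.mulVec_mulVec, ← Matrix.map_mul, h, Matrix.map_one _ (map_zero _) (map_one _),
    Matrix.one_mulVec]

variable {U V : Matrix (Fin 3) (Fin 3) k} {d : Fin 3 → k}

theorem segreOfCoord_coordOfSegre (hU : U.det ≠ 0) (hV : V.det ≠ 0) (hd : ∀ i, d i ≠ 0)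
    (z : Fin 2 × Fin 2 × Fin 2 → R) :
    segreOfCoord U V d (coordOfSegre U V d z) = z := by
  have hUU : Uᵀ * (U⁻¹)ᵀ = 1 := by
    rw [← Matrix.transpose_mul, Matrix.nonsing_inv_mul _ hU.isUnit, Matrix.transpose_one]
  have hd' : ∀ i, algebraMap k R (d i)⁻¹ * algebraMap k R (d i) = 1 := fun i => by
    rw [← map_mul, inv_mul_cancel₀ (hd i), map_one]
  have hD : ∏ i, d i ≠ 0 := Finset.prod_ne_zero_iff.mpr fun i _ => hd i
  conv_rhs => rw [← segreCoord_self z]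
  rw [segreOfCoord]
  congr 1
  · rw [coordOfSegre, ← mul_assoc, ← map_mul, inv_mul_cancel₀ hU, map_one, one_mul]
  · rw [coordOfSegre, ← map_prod, ← mul_assoc, ← mul_assoc, ← map_mul, ← map_mul,
      show V.det⁻¹ * (∏ i, d i)⁻¹ * V.det * ∏ i, d i = 1 by field_simp, map_one, one_mul]
  · simp only [coordOfSegre]
    rw [map_mulVec_map_mulVec_of_mul_eq_one hUU, ← mul_assoc,
      show (algebraMap k R ∘ d⁻¹) * (algebraMap k R ∘ d) = 1 from funext hd', one_mul]
  · simp only [coordOfSegre]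
    rw [map_mulVec_map_mulVec_of_mul_eq_one (Matrix.mul_nonsing_inv _ hV.isUnit)]

theorem coordOfSegre_segreOfCoord (hU : U.det ≠ 0) (hV : V.det ≠ 0) (hd : ∀ i, d i ≠ 0)
    (f : Coord → R) :
    coordOfSegre U V d (segreOfCoord U V d f) = f := by
  have hUU : (U⁻¹)ᵀ * Uᵀ = 1 := by
    rw [← Matrix.transpose_mul, Matrix.mul_nonsing_inv _ hU.isUnit, Matrix.transpose_one]
  have hd' : ∀ i, algebraMap k R (d i) * algebraMap k R (d i)⁻¹ = 1 := fun i => by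
    rw [← map_mul, mul_inv_cancel₀ (hd i), map_one]
  have hD : ∏ i, d i ≠ 0 := Finset.prod_ne_zero_iff.mpr fun i _ => hd i
  ext1 c
  cases c with
  | s =>
    change algebraMap k R U.det * (algebraMap k R U.det⁻¹ * f Coord.s) = _
    rw [← mul_assoc, ← map_mul, mul_inv_cancel₀ hU, map_one, one_mul]
  | t =>
    change algebraMap k R V.det * ((∏ i, algebraMap k R (d i)) *
      (algebraMap k R (V.det⁻¹ * (∏ i, d i)⁻¹) * f Coord.t)) = _
    rw [← map_prod, ← mul_assoc, ← mul_assoc, ← map_mul, ← map_mul,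
      show V.det * (∏ i, d i) * (V.det⁻¹ * (∏ i, d i)⁻¹) = 1 by field_simp, map_one, one_mul]
  | x i =>
    have h : ![segreOfCoord U V d f (0, 1, 1), segreOfCoord U V d f (1, 0, 1),
        segreOfCoord U V d f (1, 1, 0)] =
        (algebraMap k R ∘ d⁻¹) * (Uᵀ.map (algebraMap k R) *ᵥ fun i => f (Coord.x i)) := by
      ext i
      fin_cases i <;> rfl
    rw [coordOfSegre, h, ← mul_assoc,
      show (algebraMap k R ∘ d) * (algebraMap k R ∘ d⁻¹) = 1 from funext hd', one_mul,
      map_mulVec_map_mulVec_of_mul_eq_one hUU]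
  | y i =>
    have h : ![segreOfCoord U V d f (1, 0, 0), segreOfCoord U V d f (0, 1, 0),
        segreOfCoord U V d f (0, 0, 1)] =
        V.map (algebraMap k R) *ᵥ fun i => f (Coord.y i) := by
      ext i
      fin_cases i <;> rfl
    rw [coordOfSegre, h, map_mulVec_map_mulVec_of_mul_eq_one (Matrix.nonsing_inv_mul _ hV.isUnit)]

theorem isSolution_coordOfSegre_iff (h3 : (3 : k) ≠ 0) {p q : Fin 3 → k} (hU : U.det ≠ 0)
    (hV : V.det ≠ 0) (hd : ∀ i, crossProduct p q i ≠ 0) (z : Fin 2 × Fin 2 × Fin 2 → R) :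
    IsSolution ((U * Matrix.diagonal p * V).map (algebraMap k R))
      ((U * Matrix.diagonal q * V).map (algebraMap k R))
      (coordOfSegre U V (crossProduct p q) z Coord.s)
      (coordOfSegre U V (crossProduct p q) z Coord.t)
      (fun i => coordOfSegre U V (crossProduct p q) z (Coord.x i))
      (fun i => coordOfSegre U V (crossProduct p q) z (Coord.y i)) ↔ SegreRel z := by
  have hUU : Uᵀ * (U⁻¹)ᵀ = 1 := by
    rw [← Matrix.transpose_mul, Matrix.nonsing_inv_mul _ hU.isUnit, Matrix.transpose_one]
  have hdet : ∀ M : Matrix (Fin 3) (Fin 3) k,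
      algebraMap k R M.det = (M.map (algebraMap k R)).det := fun M => RingHom.map_det _ M
  have hdiag : ∀ v : Fin 3 → k, (Matrix.diagonal v).map (algebraMap k R) =
      Matrix.diagonal (algebraMap k R ∘ v) := fun v => Matrix.diagonal_map (map_zero _)
  have hcross : algebraMap k R ∘ crossProduct p q =
      crossProduct (algebraMap k R ∘ p) (algebraMap k R ∘ q) := by
    ext i
    fin_cases i <;> simp [crossProduct]
  have hdR : ∀ i, IsUnit (crossProduct (algebraMap k R ∘ p) (algebraMap k R ∘ q) i) := fun i => by
    rw [← hcross]
    exact (hd i).isUnit.map (algebraMap k R)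
  have h3R : IsUnit (3 : R) := by
    rw [← map_ofNat (algebraMap k R) 3]
    exact h3.isUnit.map (algebraMap k R)
  simp only [coordOfSegre]
  rw [Matrix.map_mul, Matrix.map_mul, Matrix.map_mul, Matrix.map_mul, hdet, hdet,
    isSolution_mul_mul_iff (by rw [← hdet]; exact hU.isUnit.map (algebraMap k R))
      (by rw [← hdet]; exact hV.isUnit.map (algebraMap k R)), ← Matrix.transpose_map,
    map_mulVec_map_mulVec_of_mul_eq_one hUU,
    map_mulVec_map_mulVec_of_mul_eq_one (Matrix.mul_nonsing_inv _ hV.isUnit), hdiag, hdiag, hcross,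
    show ∏ i, algebraMap k R (crossProduct p q i) =
      ∏ i, crossProduct (algebraMap k R ∘ p) (algebraMap k R ∘ q) i by rw [← hcross]; rfl,
    isSolution_diagonal_iff h3R hdR, segreCoord_self]

/-- The coordinate rings of `R^{PQ}` and of the cone over the Segre variety are isomorphic. -/
theorem nonempty_algEquiv (h3 : (3 : k) ≠ 0) {p q : Fin 3 → k} (hU : U.det ≠ 0)
    (hV : V.det ≠ 0) (hd : ∀ i, crossProduct p q i ≠ 0) :
    Nonempty ((MvPolynomial Coord k ⧸
      idealPQ (U * Matrix.diagonal p * V) (U * Matrix.diagonal q * V)) ≃ₐ[k]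
      (MvPolynomial (Fin 2 × Fin 2 × Fin 2) k ⧸ segreIdeal k)) := by
  set P := U * Matrix.diagonal p * V with hP
  set Q := U * Matrix.diagonal q * V with hQ
  set c : Coord → MvPolynomial Coord k ⧸ idealPQ P Q := fun i => Ideal.Quotient.mk _ (X i) with hc
  set z : Fin 2 × Fin 2 × Fin 2 → MvPolynomial (Fin 2 × Fin 2 × Fin 2) k ⧸ segreIdeal k :=
    fun u => Ideal.Quotient.mk _ (X u) with hz
  have hz' : SegreRel z := segreRel_mk_X k le_rfl
  -- The classes of the coordinates are the tautological solution over the quotient ring; the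
  -- point-level equivalence carries it to the Segre relations.
  have hc' : SegreRel (segreOfCoord U V (crossProduct p q) c) := by
    rw [← isSolution_coordOfSegre_iff h3 hU hV hd, coordOfSegre_segreOfCoord hU hV hd]
    exact (idealPQ_le_ker_iff h3 P Q (Ideal.Quotient.mkₐ k (idealPQ P Q))).mp
      (Ideal.Quotient.mkₐ_ker k (idealPQ P Q)).ge
  let φ := Ideal.Quotient.liftₐ (idealPQ P Q) (aeval (coordOfSegre U V (crossProduct p q) z))
    fun a ha => by
      have hle := (idealPQ_le_ker_iff h3 P Q
        (aeval (coordOfSegre U V (crossProduct p q) z))).mpr (by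
          simpa only [aeval_X] using (isSolution_coordOfSegre_iff h3 hU hV hd z).mpr hz')
      exact hle ha
  let ψ := Ideal.Quotient.liftₐ (segreIdeal k) (aeval (segreOfCoord U V (crossProduct p q) c))
    fun a ha => by
      have hle : segreIdeal k ≤ RingHom.ker
          (aeval (R := k) (segreOfCoord U V (crossProduct p q) c)) := by
        rw [segreIdeal, Ideal.span_le]
        rintro _ ⟨⟨u, v⟩, rfl⟩
        simp [RingHom.mem_ker, hc' u v]
      exact hle ha
  have hφ : ∀ i, φ (c i) = coordOfSegre U V (crossProduct p q) z i := fun i => aeval_X _ i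
  have hψ : ∀ u, ψ (z u) = segreOfCoord U V (crossProduct p q) c u := fun u => aeval_X _ u
  refine ⟨AlgEquiv.ofAlgHom φ ψ ?_ ?_⟩
  · refine Ideal.Quotient.algHom_ext _ (algHom_ext fun u => ?_)
    change φ (ψ (z u)) = z u
    rw [hψ, map_segreOfCoord, show φ ∘ c = _ from funext hφ, segreOfCoord_coordOfSegre hU hV hd]
  · refine Ideal.Quotient.algHom_ext _ (algHom_ext fun i => ?_)
    change ψ (φ (c i)) = c i
    rw [hφ, map_coordOfSegre, show ψ ∘ z = _ from funext hψ, coordOfSegre_segreOfCoord hU hV hd]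

/-- Isomorphic `k`-algebras have isomorphic spectra over `k`. -/
theorem nonempty_specOver_iso {k : Type u} [Field k] {A B : Type u} [CommRing A] [CommRing B]
    [Algebra k A] [Algebra k B] (e : A ≃ₐ[k] B) : Nonempty (specOver k A ≅ specOver k B) := by
  refine ⟨Over.isoMk (Scheme.Spec.mapIso e.toRingEquiv.toCommRingCatIso.op).symm ?_⟩
  change Spec.map (CommRingCat.ofHom e.symm.toRingEquiv.toRingHom) ≫
    Spec.map (CommRingCat.ofHom (algebraMap k B)) = Spec.map (CommRingCat.ofHom (algebraMap k A))
  rw [← Spec.map_comp, ← CommRingCat.ofHom_comp]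
  congr 2
  exact e.symm.toAlgHom.comp_algebraMap

end Isomorphism

end SegreFTS

theorem mainTheorem3 {k : Type u} [Field k] [IsAlgClosed k]
    (h2 : (2 : k) ≠ 0) (h3 : (3 : k) ≠ 0)
    (P Q : Matrix (Fin 3) (Fin 3) k) (hD : SegreFTS.dBeta P Q ≠ 0) :
    Nonempty (SegreFTS.schemePQ P Q ≅ SegreFTS.affineCone (Set.range (SegreFTS.segre (k := k)))) := by
  have : Infinite k := IsAlgClosed.instInfinite
  obtain ⟨U, V, p, q, hU, hV, rfl, rfl, hd⟩ := SegreFTS.exists_simultaneous_diagonal hD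
  obtain ⟨e⟩ := SegreFTS.nonempty_algEquiv h3 hU hV hd
  rw [SegreFTS.schemePQ, SegreFTS.affineCone, SegreFTS.vanishingIdeal_coneSet_segre]
  exact SegreFTS.nonempty_specOver_iso e
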